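/- Let $n\ge 2$, $\sigma>0$, let $h_1,\dots,h_n>0$ with $\sum_{k=1}^n h_k=1$, and let $1\ge \alpha_1>\alpha_2>\cdots>\alpha_n>0$ with $\alpha_n\le \tfrac12$. Consider the channel $$Y=\sum_{k=1}^n h_kX_k+Z,\qquad Z\sim\mathcal N(0,\sigma^2)\ \text{independent of } \mathbf X=(X_1,\dots,X_n),$$ and let $$\mathsf C_{\mathrm E}(\mathbf h,\boldsymbol\alpha,\sigma)=\sup I(\mathbf X;Y)$$ (in nats), where the supremum is over all laws of $\mathbf X$ with $0\le X_k\le 1$ and $\mathbb E[X_k]=\alpha_k$ for every $k\in\{1,\dots,n\}$. For $0\le i\le n-1$ put $$\mathsf H_{[i]}=\sum_{k=1}^i h_k,\qquad \bar\alpha_i=\frac{\sum_{k=i+1}^n h_k\alpha_k}{1-\mathsf H_{[i]}},$$ and let $\phi(x)=\frac1{\sqrt{2\pi}}e^{-x^2/2}$, $\mathcal Q(x)=\int_x^\infty\phi(t)\,dt$ and $(a)_+=\max\{a,0\}$. For $\delta>0$ and real numbers $\lambda_0,\dots,\lambda_{n-1}$ put $$\mathsf P=\int_0^{1+\delta}\exp\Bigl(-\lambda_0y-\sum_{i=1}^{n-1}\lambda_i\,(y-\mathsf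 H_{[i]})_+\Bigr)\,dy .$$ Then the following two bounds hold. (1) For every $\delta>0$ and all real $\lambda_0,\lambda_1,\dots,\lambda_{n-1}\ge 0$, $$\mathsf C_{\mathrm E}(\mathbf h,\boldsymbol\alpha,\sigma)\le \log\Bigl(1+\frac{\mathsf P}{\sqrt{2\pi e}\,\sigma}\Bigr)+\sum_{i=0}^{n-1}\lambda_i(1-\mathsf H_{[i]})\bar\alpha_i+\sum_{i=0}^{n-1}\frac{\lambda_i\sigma}{\sqrt{2\pi}}\Bigl(1-e^{-\frac{(1+\delta)^2}{2\sigma^2}}\Bigr).$$ (2) For every $\delta>0$, every real $\lambda_0\le 0$ and all real $\lambda_1,\dots,\lambda_{n-1}\ge 0$, $$\mathsf C_{\mathrm E}(\mathbf h,\boldsymbol\alpha,\sigma)\le \log\Bigl(1+\frac{\mathsf P}{\sqrt{2\pi e}\,\sigma}\Bigr)+\sum_{i=0}^{n-1}\lambda_i(1-\mathsf H_{[i]})\bar\alpha_i+\sum_{i=1}^{n-1}\frac{\lambda_i\sigma}{\sqrt{2\pi}}\Bigl(1-e^{-\frac{(1+\delta)^2}{2\sigma^2}}\Bigr)+\lambda_0\sigma\Bigl(\phi\bigl(\tfrac1\sigma\bigr)-\phi\bigl(\tfrac\delta\sigma\bigr)\Bigr)-\lambda_0\Bigl(\mathcal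 Q\bigl(\tfrac1\sigma\bigr)+\mathcal Q\bigl(\tfrac\delta\sigma\bigr)\Bigr).$$ -/

import Mathlib

open MeasureTheory ProbabilityTheory
open scoped ENNReal

noncomputable section

namespace OIC

/-- Mutual information `I(A;B)` in nats of a pair with joint law `ρ`: the Kullback-Leibler
divergence of the joint law from the product of its marginals. -/
def mutualInfo {A B : Type*} [MeasurableSpace A] [MeasurableSpace B]
    (ρ : Measure (A × B)) : ℝ≥0∞ :=
  InformationTheory.klDiv ρ (ρ.fst.prod ρ.snd)

/-- The joint law of `(X, Y)` with `Y = hᵀ X + Z`, where `X` has law `μ` and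
`Z ∼ N(0, σ²)` is independent of `X`. -/
def channelLaw {n : ℕ} (h : Fin n → ℝ) (σ : ℝ) (μ : Measure (Fin n → ℝ)) :
    Measure ((Fin n → ℝ) × ℝ) :=
  (μ.prod (gaussianReal 0 (σ ^ 2).toNNReal)).map
    (fun p => (p.1, ∑ k, h k * p.1 k + p.2))

/-- The input laws allowed by the equal-cost constraints: a probability law on `ℝⁿ` with
`0 ≤ X_k ≤ 1` almost surely and `E[X_k] = α_k` for every `k`. -/
structure EqualCost {n : ℕ} (α : Fin n → ℝ) (μ : Measure (Fin n → ℝ)) : Prop where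
  prob : IsProbabilityMeasure μ
  peak : ∀ᵐ x ∂μ, ∀ k, 0 ≤ x k ∧ x k ≤ 1
  mean : ∀ k, ∫ x, x k ∂μ = α k

/-- The capacity (in nats) of the equal-cost channel: the supremum of `I(X;Y)` over all
allowed input laws. -/
def capacityE {n : ℕ} (h α : Fin n → ℝ) (σ : ℝ) : ℝ≥0∞ :=
  ⨆ (μ : Measure (Fin n → ℝ)) (_ : EqualCost α μ), mutualInfo (channelLaw h σ μ)

/-- `H_[i]`, the sum of the first `i` channel gains. (Transmitter `k` of the usual `1`-based
numbering is the index `k - 1` of `Fin n`.) -/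
def cumGain {n : ℕ} (h : Fin n → ℝ) (i : ℕ) : ℝ :=
  ∑ k : Fin n with k.val < i, h k

/-- The weighted average intensity of the last `n - i` transmitters. -/
def avgTail {n : ℕ} (h α : Fin n → ℝ) (i : ℕ) : ℝ :=
  (∑ k : Fin n with i ≤ k.val, h k * α k) / (1 - cumGain h i)

/-- The standard Gaussian density. -/
def gaussPhi (x : ℝ) : ℝ := 1 / √(2 * Real.pi) * Real.exp (-x ^ 2 / 2)

/-- The Gaussian Q-function, `Q(x) = P(N(0,1) > x)`. -/
def gaussQ (x : ℝ) : ℝ := (gaussianReal 0 1).real (Set.Ioi x)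

/-- `P = ∫₀^{1+δ} exp(-λ₀ y - ∑_{i=1}^{n-1} λ_i (y - H_[i])₊) dy`. -/
def normP {n : ℕ} (h : Fin n → ℝ) (lam : ℕ → ℝ) (δ : ℝ) : ℝ :=
  ∫ y in (0 : ℝ)..(1 + δ),
    Real.exp (-lam 0 * y - ∑ i ∈ Finset.Ico 1 n, lam i * max (y - cumGain h i) 0)

end OIC

end

/-!
The mutual information `I(X; Y)` is bounded by duality. If `W(· | x)` is the Gaussian channel law and
`R` is any output law, then `I(X; Y) = E[D(W(· | X) ‖ R)] - D(P_Y ‖ R) ≤ E[D(W(· | X) ‖ R)]`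
(`OIC.mutualInfo_jointLaw_le`); only densities and the inequality `log t ≤ t - 1` are needed. The
output depends on the input only through `S = ∑ h_k X_k ∈ [0, 1]`.

The law `R` has, on the window `[0, 1 + δ]`, a density proportional to `exp (-f)`, where
`f y = λ₀ y + ∑ λ_i (y - H_[i])₊`, and two Gaussian half-bells of variance `σ²` attached at the
endpoints of the window. Give the tails the total mass `1 / (1 + k)`, with `k = P / (√(2πe) σ)`.
On the tails the exponent `(distance to the window)² / (2σ²)` has conditional mean at most `1 / 2`
(`OIC.integral_tailExcess_nonpos`, by an explicit antiderivative), which is exactly the constant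
that the window contributes. Hence the divergence is at most `log (1 + k)` plus the mean of `f (Y)`
on the event that `Y` lies in the window (`OIC.mutualInfo_jointLaw_le_window`).

It remains to estimate truncated Gaussian means.
* The mean of `(Y - H_[i])₊` on the window is at most `E[(S - H_[i])₊]` plus the noise term
  `σ / √(2π) (1 - exp (-(1 + δ)² / (2σ²)))` (`OIC.integral_window_posPart_le`). Since
  `∑_{k ≤ i} h_k X_k ≤ H_[i]`, also `E[(S - H_[i])₊] ≤ ∑_{k > i} h_k α_k = (1 - H_[i]) ᾱ_i`.
* For `λ₀ ≤ 0` the mean of `Y` on the window is needed from below. The map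
  `y ↦ y 1{y ∈ [0, 1 + δ]} - y` is antitone, so the worst value of `S` is `1`, where the mean is
  explicit (`OIC.le_integral_window_id`).
-/

noncomputable section

namespace OIC

/-! ### Mutual information over a scalar Gaussian channel -/

section Information

variable {X : Type*} [MeasurableSpace X]

/-- Joint law of `(x, s x + Z)`, where `x ∼ μ` and `Z ∼ N(0, v)` are independent: the channel sees
the input only through the real-valued statistic `s`. -/
def jointLaw (μ : Measure X) (s : X → ℝ) (v : NNReal) : Measure (X × ℝ) :=
  (μ.prod (gaussianReal 0 v)).map (fun p => (p.1, s p.1 + p.2))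

/-- Lebesgue density of the channel output `s x + Z`. -/
def outPDF (μ : Measure X) (s : X → ℝ) (v : NNReal) (y : ℝ) : ℝ≥0∞ :=
  ∫⁻ x, gaussianPDF 0 v (y - s x) ∂μ

variable {μ : Measure X} {s : X → ℝ} {v : NNReal}

lemma measurable_shear (hs : Measurable s) :
    Measurable (fun p : X × ℝ => (p.1, s p.1 + p.2)) := by fun_prop

lemma measurable_channelPDF (hs : Measurable s) :
    Measurable (fun p : X × ℝ => gaussianPDF 0 v (p.2 - s p.1)) :=
  (measurable_gaussianPDF 0 v).comp (by fun_prop)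

lemma lintegral_jointLaw (hs : Measurable s) (hv : v ≠ 0) {f : X × ℝ → ℝ≥0∞}
    (hf : Measurable f) :
    ∫⁻ p, f p ∂jointLaw μ s v =
      ∫⁻ x, ∫⁻ y, gaussianPDF 0 v (y - s x) * f (x, y) ∂volume ∂μ := by
  rw [jointLaw, lintegral_map hf (measurable_shear hs),
    lintegral_prod _ (by exact (hf.comp (measurable_shear hs)).aemeasurable)]
  refine lintegral_congr fun x => ?_
  rw [gaussianReal_of_var_ne_zero _ hv,
    lintegral_withDensity_eq_lintegral_mul _ (measurable_gaussianPDF 0 v) (by fun_prop),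
    ← lintegral_add_left_eq_self (μ := volume)
      (fun y => gaussianPDF 0 v (y - s x) * f (x, y)) (s x)]
  simp

lemma fst_jointLaw (hs : Measurable s) : (jointLaw μ s v).fst = μ := by
  rw [jointLaw, Measure.fst, Measure.map_map measurable_fst (measurable_shear hs)]
  exact Measure.fst_prod

lemma jointLaw_eq_withDensity (hs : Measurable s) (hv : v ≠ 0) :
    jointLaw μ s v =
      (μ.prod volume).withDensity (fun p => gaussianPDF 0 v (p.2 - s p.1)) := by
  refine Measure.ext_of_lintegral _ fun f hf => ?_
  rw [lintegral_jointLaw hs hv hf,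
    lintegral_withDensity_eq_lintegral_mul _ (measurable_channelPDF hs) hf,
    lintegral_prod _ (((measurable_channelPDF hs).mul hf).aemeasurable)]
  rfl

variable [IsProbabilityMeasure μ]

instance isProbabilityMeasure_jointLaw [Fact (Measurable s)] :
    IsProbabilityMeasure (jointLaw μ s v) :=
  Measure.isProbabilityMeasure_map (measurable_shear Fact.out).aemeasurable

lemma measurable_outPDF (hs : Measurable s) : Measurable (outPDF μ s v) :=
  (measurable_channelPDF hs).lintegral_prod_left'

lemma snd_jointLaw (hs : Measurable s) (hv : v ≠ 0) :
    (jointLaw μ s v).snd = volume.withDensity (outPDF μ s v) := by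
  refine Measure.ext_of_lintegral _ fun f hf => ?_
  have hm : Measurable (fun p : X × ℝ => gaussianPDF 0 v (p.2 - s p.1) * f p.2) :=
    (measurable_channelPDF hs).mul (hf.comp measurable_snd)
  rw [Measure.snd, lintegral_map hf measurable_snd,
    lintegral_jointLaw (f := fun p => f p.2) hs hv (hf.comp measurable_snd),
    lintegral_withDensity_eq_lintegral_mul _ (measurable_outPDF hs) hf,
    lintegral_lintegral_swap hm.aemeasurable]
  refine lintegral_congr fun y => ?_
  simp only [Pi.mul_apply, outPDF]
  rw [← lintegral_mul_const]
  exact (measurable_gaussianPDF 0 v).comp (by fun_prop)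

lemma gaussianPDFReal_le (y : ℝ) : gaussianPDFReal 0 v y ≤ (√(2 * Real.pi * v))⁻¹ := by
  rw [gaussianPDFReal]
  refine mul_le_of_le_one_right (by positivity) (Real.exp_le_one_iff.2 ?_)
  rw [neg_div]
  exact neg_nonpos.2 (by positivity)

lemma outPDF_le (y : ℝ) : outPDF μ s v y ≤ ENNReal.ofReal (√(2 * Real.pi * v))⁻¹ := by
  calc outPDF μ s v y ≤ ∫⁻ _, ENNReal.ofReal (√(2 * Real.pi * v))⁻¹ ∂μ :=
        lintegral_mono fun x => ENNReal.ofReal_le_ofReal (gaussianPDFReal_le _)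
    _ = _ := by simp

/-- Since the statistic stays in `[0, 1]`, the output density decays no faster than a Gaussian.
This is what makes the information density integrable. -/
lemma le_outPDF (h01 : ∀ᵐ x ∂μ, 0 ≤ s x ∧ s x ≤ 1) (y : ℝ) :
    ENNReal.ofReal ((√(2 * Real.pi * v))⁻¹ * Real.exp (-(y ^ 2 + 1) / v)) ≤ outPDF μ s v y := by
  calc _ = ∫⁻ _, ENNReal.ofReal ((√(2 * Real.pi * v))⁻¹ * Real.exp (-(y ^ 2 + 1) / v)) ∂μ := by
        simp
    _ ≤ _ := by
        refine lintegral_mono_ae (h01.mono fun x hx => ENNReal.ofReal_le_ofReal ?_)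
        rw [gaussianPDFReal]
        refine mul_le_mul_of_nonneg_left (Real.exp_le_exp.2 ?_) (by positivity)
        rw [neg_div, neg_div, neg_le_neg_iff, mul_comm 2 (v : ℝ), ← div_div, div_right_comm]
        gcongr
        nlinarith [sq_nonneg (y + s x)]

lemma outPDF_ne_top (y : ℝ) : outPDF μ s v y ≠ ∞ :=
  ((outPDF_le y).trans_lt ENNReal.ofReal_lt_top).ne

lemma outPDF_toReal_pos (h01 : ∀ᵐ x ∂μ, 0 ≤ s x ∧ s x ≤ 1) (hv : v ≠ 0) (y : ℝ) :
    0 < (outPDF μ s v y).toReal := by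
  refine ENNReal.toReal_pos (ne_of_gt (lt_of_lt_of_le ?_ (le_outPDF h01 y))) (outPDF_ne_top y)
  rw [ENNReal.ofReal_pos]
  positivity

/-- The logarithm of the output density grows at most quadratically. -/
lemma abs_log_outPDF_le (h01 : ∀ᵐ x ∂μ, 0 ≤ s x ∧ s x ≤ 1) (hv : v ≠ 0) (y : ℝ) :
    |Real.log (outPDF μ s v y).toReal| ≤
      |Real.log (√(2 * Real.pi * v))⁻¹| + (y ^ 2 + 1) / v := by
  have hc : 0 < (√(2 * Real.pi * v))⁻¹ := by positivity
  have h1 : (outPDF μ s v y).toReal ≤ (√(2 * Real.pi * v))⁻¹ :=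
    ENNReal.toReal_le_of_le_ofReal hc.le (outPDF_le y)
  have h2 : (√(2 * Real.pi * v))⁻¹ * Real.exp (-(y ^ 2 + 1) / v) ≤ (outPDF μ s v y).toReal :=
    (ENNReal.ofReal_le_iff_le_toReal (outPDF_ne_top y)).1 (le_outPDF h01 y)
  have h3 := Real.log_le_log (outPDF_toReal_pos h01 hv y) h1
  have h4 := Real.log_le_log (by positivity) h2
  rw [Real.log_mul hc.ne' (Real.exp_pos _).ne', Real.log_exp, neg_div] at h4
  have h5 : 0 ≤ (y ^ 2 + 1) / (v : ℝ) := by positivity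
  rw [abs_le]
  constructor <;> linarith [neg_abs_le (Real.log (√(2 * Real.pi * v))⁻¹),
    le_abs_self (Real.log (√(2 * Real.pi * v))⁻¹)]

lemma integrable_sq_gaussianReal (m : ℝ) (v : NNReal) :
    Integrable (fun z : ℝ => z ^ 2) (gaussianReal m v) :=
  (memLp_id_gaussianReal 2).integrable_sq

/-- A measurable function of at most quadratic growth is integrable along the channel output. -/
lemma integrable_comp_output (hs : Measurable s) (h01 : ∀ᵐ x ∂μ, 0 ≤ s x ∧ s x ≤ 1)
    {g : ℝ → ℝ} (hg : Measurable g) {A B : ℝ} (hB : 0 ≤ B) (hgb : ∀ y, |g y| ≤ A + B * y ^ 2) :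
    Integrable (fun p : X × ℝ => g (s p.1 + p.2)) (μ.prod (gaussianReal 0 v)) := by
  have hdom : Integrable (fun p : X × ℝ => (A + 2 * B) + 2 * B * p.2 ^ 2)
      (μ.prod (gaussianReal 0 v)) :=
    (integrable_const _).add (((integrable_sq_gaussianReal 0 v).comp_snd μ).const_mul _)
  refine hdom.mono' (hg.comp (by fun_prop)).aestronglyMeasurable ?_
  filter_upwards [Measure.quasiMeasurePreserving_fst.ae h01] with p hp
  rw [Real.norm_eq_abs]
  refine (hgb _).trans ?_
  have : (s p.1 + p.2) ^ 2 ≤ 2 + 2 * p.2 ^ 2 := by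
    nlinarith [sq_nonneg (s p.1 - p.2), hp.1, hp.2]
  nlinarith

lemma log_gaussianPDFReal (hv : v ≠ 0) (z : ℝ) :
    Real.log (gaussianPDFReal 0 v z) = Real.log (√(2 * Real.pi * v))⁻¹ - z ^ 2 / (2 * v) := by
  have hc : 0 < (√(2 * Real.pi * v))⁻¹ := by positivity
  rw [gaussianPDFReal, Real.log_mul hc.ne' (Real.exp_pos _).ne', Real.log_exp]
  ring

lemma jointLaw_eq_withDensity_prod (hs : Measurable s) (h01 : ∀ᵐ x ∂μ, 0 ≤ s x ∧ s x ≤ 1)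
    (hv : v ≠ 0) :
    jointLaw μ s v = (μ.prod (volume.withDensity (outPDF μ s v))).withDensity
      (fun p => (outPDF μ s v p.2)⁻¹ * gaussianPDF 0 v (p.2 - s p.1)) := by
  have hp : Measurable (fun p : X × ℝ => outPDF μ s v p.2) :=
    (measurable_outPDF hs).comp measurable_snd
  have hmul : (fun p : X × ℝ => gaussianPDF 0 v (p.2 - s p.1)) =
      (fun p => outPDF μ s v p.2) *
        fun p => (outPDF μ s v p.2)⁻¹ * gaussianPDF 0 v (p.2 - s p.1) := by
    funext p
    have h0 : outPDF μ s v p.2 ≠ 0 := fun h => by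
      have := outPDF_toReal_pos (μ := μ) h01 hv p.2
      simp [h] at this
    rw [Pi.mul_apply, ← mul_assoc, ENNReal.mul_inv_cancel h0 (outPDF_ne_top _), one_mul]
  have : SFinite (volume.withDensity (outPDF μ s v)) := inferInstance
  rw [jointLaw_eq_withDensity hs hv, prod_withDensity_right (measurable_outPDF hs)]
  conv_lhs => rw [hmul]
  exact withDensity_mul _ hp (hp.inv.mul (measurable_channelPDF hs))

/-- Duality bound for mutual information. For every auxiliary output density `r`, the mutual
information is at most the mean of `log (p(y|x) / r(y))`; the defect is the divergence of the true
output law from `r`, which is nonnegative. -/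
theorem mutualInfo_jointLaw_le (hs : Measurable s) (h01 : ∀ᵐ x ∂μ, 0 ≤ s x ∧ s x ≤ 1)
    (hv : v ≠ 0) {r : ℝ → ℝ} (hr : Measurable r) (hr0 : ∀ y, 0 < r y)
    (hr1 : ∫⁻ y, ENNReal.ofReal (r y) ≤ 1) {A B : ℝ} (hB : 0 ≤ B)
    (hrb : ∀ y, |Real.log (r y)| ≤ A + B * y ^ 2) :
    mutualInfo (jointLaw μ s v) ≠ ∞ ∧ (mutualInfo (jointLaw μ s v)).toReal ≤
      ∫ p, (Real.log (gaussianPDFReal 0 v p.2) - Real.log (r (s p.1 + p.2)))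
        ∂(μ.prod (gaussianReal 0 v)) := by
  have : Fact (Measurable s) := ⟨hs⟩
  have hp := measurable_outPDF (μ := μ) (v := v) hs
  have hsh := measurable_shear hs
  set ν : Measure ℝ := volume.withDensity (outPDF μ s v) with hν
  have hsnd : (jointLaw μ s v).snd = ν := snd_jointLaw hs hv
  have : IsProbabilityMeasure ν := hsnd ▸ inferInstance
  have hd := jointLaw_eq_withDensity_prod (μ := μ) hs h01 hv
  rw [← hν] at hd
  have hac : jointLaw μ s v ≪ μ.prod ν := by
    rw [hd]; exact withDensity_absolutelyContinuous _ _
  have hFm : Measurable (fun p : X × ℝ =>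
      (outPDF μ s v p.2)⁻¹ * gaussianPDF 0 v (p.2 - s p.1)) :=
    (hp.comp measurable_snd).inv.mul (measurable_channelPDF hs)
  -- the information density
  have hllr : llr (jointLaw μ s v) (μ.prod ν) =ᵐ[jointLaw μ s v] fun p =>
      Real.log (gaussianPDFReal 0 v (p.2 - s p.1)) - Real.log (outPDF μ s v p.2).toReal := by
    have h1 : (jointLaw μ s v).rnDeriv (μ.prod ν) =ᵐ[μ.prod ν] fun p =>
        (outPDF μ s v p.2)⁻¹ * gaussianPDF 0 v (p.2 - s p.1) := by
      conv_lhs => rw [hd]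
      exact Measure.rnDeriv_withDensity _ hFm
    filter_upwards [hac.ae_le h1] with p hp'
    rw [llr, hp', ENNReal.toReal_mul, ENNReal.toReal_inv, toReal_gaussianPDF,
      Real.log_mul (inv_ne_zero (outPDF_toReal_pos h01 hv _).ne')
        (gaussianPDFReal_pos _ _ _ hv).ne', Real.log_inv]
    ring
  have hint1 : Integrable (fun p : X × ℝ => Real.log (gaussianPDFReal 0 v p.2))
      (μ.prod (gaussianReal 0 v)) := by
    simp_rw [log_gaussianPDFReal hv]
    exact (integrable_const _).sub (((integrable_sq_gaussianReal 0 v).comp_snd μ).div_const _)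
  have hint2 : Integrable (fun p : X × ℝ => Real.log (outPDF μ s v (s p.1 + p.2)).toReal)
      (μ.prod (gaussianReal 0 v)) := by
    refine integrable_comp_output (g := fun y => Real.log (outPDF μ s v y).toReal) hs h01
      (Real.measurable_log.comp hp.ennreal_toReal)
      (A := |Real.log (√(2 * Real.pi * v))⁻¹| + 1 / v) (B := 1 / v) (by positivity) fun y => ?_
    refine (abs_log_outPDF_le h01 hv y).trans (le_of_eq ?_)
    ring
  have hint3 : Integrable (fun p : X × ℝ => Real.log (r (s p.1 + p.2)))
      (μ.prod (gaussianReal 0 v)) :=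
    integrable_comp_output (g := fun y => Real.log (r y)) hs h01
      (Real.measurable_log.comp hr) hB hrb
  have hdm : Measurable (fun p : X × ℝ =>
      Real.log (gaussianPDFReal 0 v (p.2 - s p.1)) - Real.log (outPDF μ s v p.2).toReal) :=
    (Real.measurable_log.comp ((measurable_gaussianPDFReal 0 v).comp (by fun_prop))).sub
      (Real.measurable_log.comp (hp.comp measurable_snd).ennreal_toReal)
  have hintll : Integrable (llr (jointLaw μ s v) (μ.prod ν)) (jointLaw μ s v) := by
    rw [integrable_congr hllr, jointLaw,
      integrable_map_measure hdm.aestronglyMeasurable hsh.aemeasurable]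
    refine (hint1.sub hint2).congr (Filter.Eventually.of_forall fun p => ?_)
    simp
  have hmi : mutualInfo (jointLaw μ s v) =
      InformationTheory.klDiv (jointLaw μ s v) (μ.prod ν) := by
    rw [mutualInfo, hsnd, fst_jointLaw hs]
  refine ⟨hmi ▸ InformationTheory.klDiv_ne_top hac hintll, ?_⟩
  rw [hmi, InformationTheory.toReal_klDiv_of_measure_eq hac (by simp), integral_congr_ae hllr]
  have hI : ∫ p, (Real.log (gaussianPDFReal 0 v (p.2 - s p.1))
      - Real.log (outPDF μ s v p.2).toReal) ∂jointLaw μ s v =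
      ∫ p, (Real.log (gaussianPDFReal 0 v p.2) - Real.log (outPDF μ s v (s p.1 + p.2)).toReal)
        ∂(μ.prod (gaussianReal 0 v)) := by
    rw [jointLaw, integral_map hsh.aemeasurable hdm.aestronglyMeasurable]
    simp
  rw [hI]
  -- the ratio `r / p` of output densities has mean at most one under the output law
  have hq : ∫⁻ p : X × ℝ, ENNReal.ofReal (r (s p.1 + p.2) / (outPDF μ s v (s p.1 + p.2)).toReal)
      ∂(μ.prod (gaussianReal 0 v)) ≤ 1 := by
    have hgm : Measurable fun y : ℝ => ENNReal.ofReal (r y / (outPDF μ s v y).toReal) :=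
      (hr.div hp.ennreal_toReal).ennreal_ofReal
    calc _ = ∫⁻ y, ENNReal.ofReal (r y / (outPDF μ s v y).toReal) ∂ν := by
          rw [← hsnd, Measure.snd, lintegral_map hgm measurable_snd, jointLaw,
            lintegral_map (f := fun p : X × ℝ =>
              ENNReal.ofReal (r p.2 / (outPDF μ s v p.2).toReal)) (hgm.comp measurable_snd) hsh]
      _ = ∫⁻ y, ENNReal.ofReal (r y) := by
          rw [hν, lintegral_withDensity_eq_lintegral_mul _ hp hgm]
          refine lintegral_congr fun y => ?_
          have h0 := outPDF_toReal_pos (μ := μ) h01 hv y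
          rw [Pi.mul_apply, ENNReal.ofReal_div_of_pos h0, ENNReal.ofReal_toReal (outPDF_ne_top y),
            ENNReal.mul_div_cancel (fun h => by simp [h] at h0) (outPDF_ne_top y)]
      _ ≤ 1 := hr1
  have hratm : Measurable (fun p : X × ℝ =>
      r (s p.1 + p.2) / (outPDF μ s v (s p.1 + p.2)).toReal) :=
    (hr.comp (by fun_prop)).div (hp.comp (by fun_prop)).ennreal_toReal
  have hrat0 : ∀ p : X × ℝ, 0 ≤ r (s p.1 + p.2) / (outPDF μ s v (s p.1 + p.2)).toReal :=
    fun p => div_nonneg (hr0 _).le ENNReal.toReal_nonneg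
  have hratint : Integrable (fun p : X × ℝ =>
      r (s p.1 + p.2) / (outPDF μ s v (s p.1 + p.2)).toReal) (μ.prod (gaussianReal 0 v)) := by
    refine ⟨hratm.aestronglyMeasurable, ?_⟩
    rw [hasFiniteIntegral_iff_ofReal (Filter.Eventually.of_forall hrat0)]
    exact hq.trans_lt ENNReal.one_lt_top
  have hrat1 : ∫ p : X × ℝ, r (s p.1 + p.2) / (outPDF μ s v (s p.1 + p.2)).toReal
      ∂(μ.prod (gaussianReal 0 v)) ≤ 1 := by
    rw [integral_eq_lintegral_of_nonneg_ae (Filter.Eventually.of_forall hrat0)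
      hratm.aestronglyMeasurable]
    exact ENNReal.toReal_le_of_le_ofReal zero_le_one (by simpa using hq)
  -- nonnegativity of the divergence of the output law from `r`, through `log t ≤ t - 1`
  have hgibbs : ∫ p : X × ℝ, (Real.log (r (s p.1 + p.2))
      - Real.log (outPDF μ s v (s p.1 + p.2)).toReal) ∂(μ.prod (gaussianReal 0 v)) ≤ 0 := by
    calc _ ≤ ∫ p : X × ℝ, (r (s p.1 + p.2) / (outPDF μ s v (s p.1 + p.2)).toReal - 1)
          ∂(μ.prod (gaussianReal 0 v)) := by
          refine integral_mono (hint3.sub hint2) (hratint.sub (integrable_const _)) fun p => ?_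
          have h0 := outPDF_toReal_pos (μ := μ) h01 hv (s p.1 + p.2)
          simp only
          rw [← Real.log_div (hr0 _).ne' h0.ne']
          exact Real.log_le_sub_one_of_pos (div_pos (hr0 _) h0)
      _ ≤ 0 := by
          rw [integral_sub hratint (integrable_const _)]
          simpa using hrat1
  rw [integral_sub hint3 hint2] at hgibbs
  rw [integral_sub hint1 hint2, integral_sub hint1 hint3]
  linarith

end Information

/-! ### Truncated moments of a centred Gaussian -/

section Gaussian

variable {v : NNReal}

lemma hasDerivAt_gaussianPDFReal (hv : v ≠ 0) (z : ℝ) :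
    HasDerivAt (gaussianPDFReal 0 v) (-(z / v) * gaussianPDFReal 0 v z) z := by
  have hv' : (v : ℝ) ≠ 0 := by exact_mod_cast hv
  have h1 : HasDerivAt (fun x : ℝ => -(x - 0) ^ 2 / (2 * (v : ℝ))) (-(z / v)) z := by
    have h := ((((hasDerivAt_id z).sub_const 0).pow 2).neg).div_const (2 * (v : ℝ))
    refine h.congr_deriv ?_
    simp
    field_simp
  refine (h1.exp.const_mul (√(2 * Real.pi * v))⁻¹).congr_deriv ?_
  rw [gaussianPDFReal]
  ring

lemma gaussianPDFReal_neg (z : ℝ) : gaussianPDFReal 0 v (-z) = gaussianPDFReal 0 v z := by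
  simp [gaussianPDFReal]

lemma integrable_gaussianPDFReal_mul (hv : v ≠ 0) {f : ℝ → ℝ}
    (hf : Integrable f (gaussianReal 0 v)) : Integrable (fun z => gaussianPDFReal 0 v z * f z) := by
  rw [gaussianReal_of_var_ne_zero _ hv, integrable_withDensity_iff_integrable_smul'
    (measurable_gaussianPDF 0 v) (Filter.Eventually.of_forall fun _ => gaussianPDF_lt_top)] at hf
  simpa using hf

lemma setIntegral_gaussianReal (hv : v ≠ 0) {S : Set ℝ} (hS : MeasurableSet S) (f : ℝ → ℝ) :
    ∫ z in S, f z ∂gaussianReal 0 v = ∫ z in S, gaussianPDFReal 0 v z * f z := by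
  rw [← integral_indicator hS, integral_gaussianReal_eq_integral_smul hv, ← integral_indicator hS]
  congr 1
  funext z
  by_cases hz : z ∈ S <;> simp [hz]

lemma integrable_id_gaussianReal : Integrable (fun z : ℝ => z) (gaussianReal 0 v) :=
  (memLp_id_gaussianReal 1).integrable le_rfl

/-- Antiderivative of `(z ^ 2 - a z - v)` against the Gaussian density. -/
lemma hasDerivAt_sub_mul_gaussianPDFReal (hv : v ≠ 0) (a z : ℝ) :
    HasDerivAt (fun z => -(v * ((z - a) * gaussianPDFReal 0 v z)))
      (gaussianPDFReal 0 v z * (z ^ 2 - a * z - v)) z := by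
  have hv' : (v : ℝ) ≠ 0 := by exact_mod_cast hv
  refine (((((hasDerivAt_id z).sub_const a).mul
    (hasDerivAt_gaussianPDFReal hv z)).const_mul (v : ℝ)).neg).congr_deriv ?_
  simp
  field_simp
  ring

lemma integrable_quadratic_gaussianReal (a b c : ℝ) :
    Integrable (fun z : ℝ => a * z ^ 2 + b * z + c) (gaussianReal 0 v) :=
  (((integrable_sq_gaussianReal 0 v).const_mul a).add
    (integrable_id_gaussianReal.const_mul b)).add (integrable_const c)

lemma integrable_deriv_sub_mul_gaussianPDFReal (hv : v ≠ 0) (a : ℝ) :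
    Integrable (fun z => gaussianPDFReal 0 v z * (z ^ 2 - a * z - v)) := by
  refine integrable_gaussianPDFReal_mul hv ?_
  refine (integrable_quadratic_gaussianReal 1 (-a) (-v)).congr
    (Filter.Eventually.of_forall fun z => ?_)
  simp only
  ring

lemma integrable_sub_mul_gaussianPDFReal (hv : v ≠ 0) (a : ℝ) :
    Integrable (fun z => -(v * ((z - a) * gaussianPDFReal 0 v z))) := by
  refine ((integrable_gaussianPDFReal_mul hv
    (integrable_quadratic_gaussianReal 0 1 (-a))).const_mul (-(v : ℝ))).congr
    (Filter.Eventually.of_forall fun z => ?_)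
  simp only
  ring

lemma setIntegral_Ioi_quadratic (hv : v ≠ 0) (a : ℝ) :
    ∫ z in Set.Ioi a, (z ^ 2 - a * z - v) ∂gaussianReal 0 v = 0 := by
  have hd := fun z (_ : z ∈ Set.Ioi a) => hasDerivAt_sub_mul_gaussianPDFReal hv a z
  have h1 := (integrable_deriv_sub_mul_gaussianPDFReal hv a).integrableOn (s := Set.Ioi a)
  have h2 := (integrable_sub_mul_gaussianPDFReal hv a).integrableOn (s := Set.Ioi a)
  rw [setIntegral_gaussianReal hv measurableSet_Ioi, integral_Ioi_of_hasDerivAt_of_tendsto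
    (hasDerivAt_sub_mul_gaussianPDFReal hv a a).continuousAt.continuousWithinAt hd h1
    (tendsto_zero_of_hasDerivAt_of_integrableOn_Ioi hd h1 h2)]
  simp

lemma setIntegral_Iic_quadratic (hv : v ≠ 0) (a : ℝ) :
    ∫ z in Set.Iic a, (z ^ 2 - a * z - v) ∂gaussianReal 0 v = 0 := by
  have hd := fun z (_ : z ∈ Set.Iic a) => hasDerivAt_sub_mul_gaussianPDFReal hv a z
  have h1 := (integrable_deriv_sub_mul_gaussianPDFReal hv a).integrableOn (s := Set.Iic a)
  have h2 := (integrable_sub_mul_gaussianPDFReal hv a).integrableOn (s := Set.Iic a)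
  rw [setIntegral_gaussianReal hv measurableSet_Iic, integral_Iic_of_hasDerivAt_of_tendsto
    (hasDerivAt_sub_mul_gaussianPDFReal hv a a).continuousAt.continuousWithinAt
    (fun z hz => hd z (Set.Iio_subset_Iic_self hz)) h1
    (tendsto_zero_of_hasDerivAt_of_integrableOn_Iic hd h1 h2)]
  simp

/-- On the upper tail beyond `a ≥ 0` the squared excess has conditional mean at most the
variance. -/
lemma setIntegral_Ioi_sq_sub_le (hv : v ≠ 0) {a : ℝ} (ha : 0 ≤ a) :
    ∫ z in Set.Ioi a, ((z - a) ^ 2 - v) ∂gaussianReal 0 v ≤ 0 := by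
  refine (setIntegral_mono_on ?_ ?_ measurableSet_Ioi fun z hz => ?_).trans_eq
    (setIntegral_Ioi_quadratic hv a)
  · refine ((integrable_quadratic_gaussianReal 1 (-2 * a) (a ^ 2 - v)).congr
      (Filter.Eventually.of_forall fun z => ?_)).integrableOn
    simp only
    ring
  · refine ((integrable_quadratic_gaussianReal 1 (-a) (-v)).congr
      (Filter.Eventually.of_forall fun z => ?_)).integrableOn
    simp only
    ring
  · have hz' : a < z := hz
    nlinarith

/-- On the lower tail below `a ≤ 0` the squared excess has conditional mean at most the
variance. -/
lemma setIntegral_Iio_sq_sub_le (hv : v ≠ 0) {a : ℝ} (ha : a ≤ 0) :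
    ∫ z in Set.Iio a, ((z - a) ^ 2 - v) ∂gaussianReal 0 v ≤ 0 := by
  have := nullSingletonClass_gaussianReal (μ := 0) hv
  rw [← integral_Iic_eq_integral_Iio]
  refine (setIntegral_mono_on ?_ ?_ measurableSet_Iic fun z hz => ?_).trans_eq
    (setIntegral_Iic_quadratic hv a)
  · refine ((integrable_quadratic_gaussianReal 1 (-2 * a) (a ^ 2 - v)).congr
      (Filter.Eventually.of_forall fun z => ?_)).integrableOn
    simp only
    ring
  · refine ((integrable_quadratic_gaussianReal 1 (-a) (-v)).congr
      (Filter.Eventually.of_forall fun z => ?_)).integrableOn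
    simp only
    ring
  · have hz' : z ≤ a := hz
    nlinarith

lemma setIntegral_Icc_id (hv : v ≠ 0) {u w : ℝ} (huw : u ≤ w) :
    ∫ z in Set.Icc u w, z ∂gaussianReal 0 v =
      v * gaussianPDFReal 0 v u - v * gaussianPDFReal 0 v w := by
  have hv' : (v : ℝ) ≠ 0 := by exact_mod_cast hv
  have hd : ∀ z, HasDerivAt (fun z => -(v * gaussianPDFReal 0 v z))
      (gaussianPDFReal 0 v z * z) z := fun z => by
    refine ((hasDerivAt_gaussianPDFReal hv z).const_mul (v : ℝ)).neg.congr_deriv ?_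
    field_simp
  rw [setIntegral_gaussianReal hv measurableSet_Icc, integral_Icc_eq_integral_Ioc,
    ← intervalIntegral.integral_of_le huw,
    intervalIntegral.integral_eq_sub_of_hasDerivAt (fun z _ => hd z)
      (integrable_gaussianPDFReal_mul hv integrable_id_gaussianReal).intervalIntegrable]
  ring

lemma var_mul_gaussianPDFReal {σ : ℝ} (hσ : 0 < σ) (z : ℝ) :
    σ ^ 2 * gaussianPDFReal 0 (σ ^ 2).toNNReal z =
      σ / √(2 * Real.pi) * Real.exp (-z ^ 2 / (2 * σ ^ 2)) := by
  rw [gaussianPDFReal, Real.coe_toNNReal _ (sq_nonneg σ), Real.sqrt_mul (by positivity),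
    Real.sqrt_sq hσ.le, sub_zero]
  have : √(2 * Real.pi) ≠ 0 := by positivity
  field_simp

lemma var_mul_gaussianPDFReal_eq_gaussPhi {σ : ℝ} (hσ : 0 < σ) (z : ℝ) :
    σ ^ 2 * gaussianPDFReal 0 (σ ^ 2).toNNReal z = σ * gaussPhi (z / σ) := by
  rw [var_mul_gaussianPDFReal hσ, gaussPhi, div_pow]
  have : -z ^ 2 / (2 * σ ^ 2) = -(z ^ 2 / σ ^ 2) / 2 := by field_simp
  rw [this]
  ring

lemma toNNReal_sq_ne_zero {σ : ℝ} (hσ : 0 < σ) : (σ ^ 2).toNNReal ≠ 0 :=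
  (Real.toNNReal_pos.2 (by positivity)).ne'

lemma gaussQ_div_eq {σ : ℝ} (hσ : 0 < σ) (x : ℝ) :
    gaussQ (x / σ) = (gaussianReal 0 (σ ^ 2).toNNReal).real (Set.Ioi x) := by
  have h : (gaussianReal 0 1).map (σ * ·) = gaussianReal 0 (σ ^ 2).toNNReal := by
    rw [gaussianReal_map_const_mul, mul_zero, mul_one]
    congr 1
    ext
    simp [sq_nonneg]
  rw [gaussQ, ← h, map_measureReal_apply (by fun_prop) measurableSet_Ioi]
  congr 1
  ext y
  simp [div_lt_iff₀' hσ]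

lemma measureReal_Iio_neg (x : ℝ) :
    (gaussianReal 0 v).real (Set.Iio (-x)) = (gaussianReal 0 v).real (Set.Ioi x) := by
  have h : (gaussianReal 0 v).map (fun z => -z) = gaussianReal 0 v := by
    rw [gaussianReal_map_neg, neg_zero]
  conv_lhs => rw [← h, map_measureReal_apply (by fun_prop) measurableSet_Iio]
  congr 1
  ext y
  simp

lemma measureReal_Icc_eq {σ : ℝ} (hσ : 0 < σ) {a b : ℝ} (hab : -a ≤ b) :
    (gaussianReal 0 (σ ^ 2).toNNReal).real (Set.Icc (-a) b) =
      1 - gaussQ (a / σ) - gaussQ (b / σ) := by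
  rw [gaussQ_div_eq hσ, gaussQ_div_eq hσ, ← measureReal_Iio_neg]
  have h1 : (gaussianReal 0 (σ ^ 2).toNNReal).real (Set.Icc (-a) b)ᶜ =
      (gaussianReal 0 (σ ^ 2).toNNReal).real (Set.Iio (-a)) +
      (gaussianReal 0 (σ ^ 2).toNNReal).real (Set.Ioi b) := by
    rw [← measureReal_union _ measurableSet_Ioi]
    · congr 1
      ext y
      simp only [Set.mem_compl_iff, Set.mem_Icc, Set.mem_union, Set.mem_Iio, Set.mem_Ioi]
      grind
    · exact Set.disjoint_left.2 fun y hy hy' => by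
        simp only [Set.mem_Iio, Set.mem_Ioi] at hy hy'
        linarith
  rw [probReal_compl_eq_one_sub measurableSet_Icc] at h1
  linarith

/-- Mean of the part of `(s + Z - a)₊` seen in the window `[0, T]`: at most `(s - a)₊` plus the
contribution of the noise, which is largest when the window for `Z` starts at the origin. -/
lemma integral_window_posPart_le {σ : ℝ} (hσ : 0 < σ) {T s a : ℝ} (hs0 : 0 ≤ s) (hsT : s ≤ T)
    (ha0 : 0 ≤ a) (haT : a ≤ T) :
    ∫ z, (Set.Icc 0 T).indicator (fun y => max (y - a) 0) (s + z)
        ∂gaussianReal 0 (σ ^ 2).toNNReal ≤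
      max (s - a) 0 + σ / √(2 * Real.pi) * (1 - Real.exp (-T ^ 2 / (2 * σ ^ 2))) := by
  have hv := toNNReal_sq_ne_zero hσ
  set γ := gaussianReal 0 (σ ^ 2).toNNReal
  have hid : Integrable (fun z : ℝ => z) γ := integrable_id_gaussianReal
  have hint : Integrable (fun z : ℝ => max (s - a) 0 + z) γ := (integrable_const _).add hid
  calc _ ≤ ∫ z, (Set.Icc (a - s) (T - s)).indicator (fun z => max (s - a) 0 + z) z ∂γ := by
        refine integral_mono_of_nonneg (Filter.Eventually.of_forall fun z =>
          Set.indicator_nonneg (fun _ _ => le_max_right _ _) _)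
          (hint.indicator measurableSet_Icc) (Filter.Eventually.of_forall fun z => ?_)
        by_cases h1 : s + z ∈ Set.Icc 0 T
        · simp only [Set.indicator_of_mem h1]
          by_cases h2 : a ≤ s + z
          · have hz : z ∈ Set.Icc (a - s) (T - s) := ⟨by linarith, by linarith [h1.2]⟩
            rw [Set.indicator_of_mem hz]
            exact max_le (by linarith [le_max_left (s - a) 0])
              (by rcases le_total s a with h | h
                  · linarith [le_max_right (s - a) 0]
                  · linarith [le_max_left (s - a) 0])
          · rw [max_eq_right (by linarith), Set.indicator_of_notMem]
            exact fun h => h2 (by linarith [h.1])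
        · simp only [Set.indicator_of_notMem h1]
          rw [Set.indicator_of_notMem]
          exact fun h => h1 ⟨by linarith [h.1], by linarith [h.2]⟩
    _ = γ.real (Set.Icc (a - s) (T - s)) * max (s - a) 0 +
        (σ / √(2 * Real.pi) * Real.exp (-(a - s) ^ 2 / (2 * σ ^ 2)) -
          σ / √(2 * Real.pi) * Real.exp (-(T - s) ^ 2 / (2 * σ ^ 2))) := by
        rw [integral_indicator measurableSet_Icc, integral_add (integrable_const _).integrableOn
          hid.integrableOn, setIntegral_Icc_id hv (by linarith),
          Real.coe_toNNReal _ (sq_nonneg σ), var_mul_gaussianPDFReal hσ,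
          var_mul_gaussianPDFReal hσ, setIntegral_const, smul_eq_mul]
    _ ≤ _ := by
        have h1 : γ.real (Set.Icc (a - s) (T - s)) * max (s - a) 0 ≤ max (s - a) 0 :=
          mul_le_of_le_one_left (le_max_right _ _) measureReal_le_one
        have h2 : Real.exp (-(a - s) ^ 2 / (2 * σ ^ 2)) ≤ 1 := by
          rw [Real.exp_le_one_iff, neg_div]
          exact neg_nonpos.2 (by positivity)
        have h3 : Real.exp (-T ^ 2 / (2 * σ ^ 2)) ≤ Real.exp (-(T - s) ^ 2 / (2 * σ ^ 2)) := by
          rw [Real.exp_le_exp]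
          apply div_le_div_of_nonneg_right _ (by positivity)
          nlinarith
        have h4 : 0 ≤ σ / √(2 * Real.pi) := by positivity
        nlinarith

/-- The error made by replacing `y` with `0` outside a window that starts at `0` is antitone. -/
lemma antitone_window_sub_id {T : ℝ} :
    Antitone fun y => (Set.Icc 0 T).indicator (fun y => y) y - y := by
  intro a b hab
  by_cases ha : a ∈ Set.Icc 0 T <;> by_cases hb : b ∈ Set.Icc 0 T <;>
    simp only [Set.indicator_of_mem, Set.indicator_of_notMem, ha, hb, not_false_eq_true] <;>
    simp only [Set.mem_Icc, not_and_or, not_le] at ha hb <;> grind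

lemma integrable_window {T : ℝ} {f : ℝ → ℝ} (hf : Continuous f) (s : ℝ) :
    Integrable (fun z => (Set.Icc 0 T).indicator f (s + z)) (gaussianReal 0 v) := by
  obtain ⟨C, hC⟩ := (isCompact_Icc (a := (0 : ℝ)) (b := T)).exists_bound_of_continuousOn
    hf.continuousOn
  refine (integrable_const (max C 0)).mono'
    ((hf.measurable.indicator measurableSet_Icc).comp (by fun_prop)).aestronglyMeasurable
    (Filter.Eventually.of_forall fun z => ?_)
  by_cases h : s + z ∈ Set.Icc 0 T
  · rw [Set.indicator_of_mem h]
    exact (hC _ h).trans (le_max_left _ _)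
  · rw [Set.indicator_of_notMem h, norm_zero]
    exact le_max_right _ _

/-- Mean of the part of `s + Z` seen in the window `[0, 1 + δ]`, bounded from below: the deficit
with respect to `s` is largest for `s = 1`, where it is computed explicitly. -/
lemma le_integral_window_id {σ : ℝ} (hσ : 0 < σ) {δ s : ℝ} (hδ : 0 < δ) (hs1 : s ≤ 1) :
    s + σ * (gaussPhi (1 / σ) - gaussPhi (δ / σ)) - (gaussQ (1 / σ) + gaussQ (δ / σ)) ≤
      ∫ z, (Set.Icc 0 (1 + δ)).indicator (fun y => y) (s + z)
        ∂gaussianReal 0 (σ ^ 2).toNNReal := by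
  have hv := toNNReal_sq_ne_zero hσ
  set γ := gaussianReal 0 (σ ^ 2).toNNReal
  have hid : Integrable (fun z : ℝ => z) γ := integrable_id_gaussianReal
  have hlin : ∀ c : ℝ, Integrable (fun z : ℝ => c + z) γ := fun c => (integrable_const _).add hid
  have hw : ∀ c : ℝ, Integrable
      (fun z => (Set.Icc 0 (1 + δ)).indicator (fun y => y) (c + z)) γ :=
    fun c => integrable_window continuous_id c
  have hmean : ∀ c : ℝ, ∫ z, (c + z) ∂γ = c := fun c => by
    rw [integral_add (integrable_const _) hid, integral_id_gaussianReal]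
    simp
  have hmono : ∫ z, ((Set.Icc 0 (1 + δ)).indicator (fun y => y) (1 + z) - (1 + z)) ∂γ ≤
      ∫ z, ((Set.Icc 0 (1 + δ)).indicator (fun y => y) (s + z) - (s + z)) ∂γ :=
    integral_mono ((hw 1).sub (hlin 1)) ((hw s).sub (hlin s)) fun z =>
      antitone_window_sub_id (by linarith)
  rw [integral_sub (hw 1) (hlin 1), integral_sub (hw s) (hlin s), hmean, hmean] at hmono
  have hone : ∫ z, (Set.Icc 0 (1 + δ)).indicator (fun y => y) (1 + z) ∂γ =
      1 - gaussQ (1 / σ) - gaussQ (δ / σ) +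
        (σ * gaussPhi (1 / σ) - σ * gaussPhi (δ / σ)) := by
    have hind : (fun z => (Set.Icc 0 (1 + δ)).indicator (fun y => y) (1 + z)) =
        (Set.Icc (-1) δ).indicator (fun z => 1 + z) := by
      funext z
      by_cases hz : z ∈ Set.Icc (-1) δ
      · rw [Set.indicator_of_mem hz, Set.indicator_of_mem]
        exact ⟨by linarith [hz.1], by linarith [hz.2]⟩
      · rw [Set.indicator_of_notMem hz, Set.indicator_of_notMem]
        exact fun h => hz ⟨by linarith [h.1], by linarith [h.2]⟩
    rw [hind, integral_indicator measurableSet_Icc, integral_add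
      (integrable_const _).integrableOn hid.integrableOn, setIntegral_Icc_id hv (by linarith),
      Real.coe_toNNReal _ (sq_nonneg σ), gaussianPDFReal_neg,
      var_mul_gaussianPDFReal_eq_gaussPhi hσ, var_mul_gaussianPDFReal_eq_gaussPhi hσ,
      setIntegral_const, smul_eq_mul, mul_one, measureReal_Icc_eq hσ (by linarith)]
  rw [hone] at hmono
  linarith

end Gaussian

/-! ### Output densities with Gaussian tails outside a window -/

section Window

/-- Negative log-density, up to a constant, of the auxiliary output law: `1 / 2 + f` on the window
`[0, T]` and Gaussian tails of variance `v`, centred at the nearest endpoint, outside of it. -/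
def windowPenalty (f : ℝ → ℝ) (T : ℝ) (v : NNReal) (y : ℝ) : ℝ :=
  if y < 0 then y ^ 2 / (2 * v) else if T < y then (y - T) ^ 2 / (2 * v) else 1 / 2 + f y

/-- The part of `windowPenalty` that comes from the tails, relative to the level `1 / 2`. -/
def tailExcess (T : ℝ) (v : NNReal) (y : ℝ) : ℝ :=
  (Set.Iio 0).indicator (fun y => y ^ 2 - (v : ℝ)) y +
    (Set.Ioi T).indicator (fun y => (y - T) ^ 2 - (v : ℝ)) y

variable {f : ℝ → ℝ} {T : ℝ} {v : NNReal}

lemma windowPenalty_eq (hv : v ≠ 0) (hT : 0 ≤ T) (y : ℝ) :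
    windowPenalty f T v y =
      1 / 2 + (Set.Icc 0 T).indicator f y + tailExcess T v y / (2 * v) := by
  have hv' : (v : ℝ) ≠ 0 := by exact_mod_cast hv
  rw [windowPenalty, tailExcess]
  by_cases h0 : y < 0
  · have h1 : y ∉ Set.Icc 0 T := fun h => absurd h.1 (by linarith)
    have h2 : y ∉ Set.Ioi T := fun h => absurd (Set.mem_Ioi.1 h) (by linarith)
    rw [if_pos h0, Set.indicator_of_notMem h1, Set.indicator_of_mem (by exact h0),
      Set.indicator_of_notMem h2]
    field_simp
    ring
  · by_cases hT' : T < y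
    · have h1 : y ∉ Set.Icc 0 T := fun h => absurd h.2 (by linarith)
      rw [if_neg h0, if_pos hT', Set.indicator_of_notMem h1,
        Set.indicator_of_notMem (by simpa using h0), Set.indicator_of_mem (by exact hT')]
      field_simp
      ring
    · have h1 : y ∈ Set.Icc 0 T := ⟨by linarith, by linarith⟩
      rw [if_neg h0, if_neg hT', Set.indicator_of_mem h1,
        Set.indicator_of_notMem (by simpa using h0),
        Set.indicator_of_notMem (by simpa using hT')]
      ring

lemma measurable_windowPenalty (hf : Continuous f) : Measurable (windowPenalty f T v) := by
  refine Measurable.ite measurableSet_Iio (by fun_prop)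
    (Measurable.ite measurableSet_Ioi (by fun_prop) ?_)
  exact (continuous_const.add hf).measurable

lemma exists_abs_windowPenalty_le (hf : Continuous f) (hT : 0 ≤ T) (v : NNReal) :
    ∃ C, ∀ y, |windowPenalty f T v y| ≤ C + 1 / (2 * v) * y ^ 2 := by
  obtain ⟨C, hC⟩ := (isCompact_Icc (a := (0 : ℝ)) (b := T)).exists_bound_of_continuousOn
    hf.continuousOn
  have hC0 : 0 ≤ C := (norm_nonneg _).trans (hC 0 ⟨le_rfl, hT⟩)
  have hv : (0 : ℝ) ≤ 2 * v := by positivity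
  refine ⟨1 / 2 + C, fun y => ?_⟩
  have hy : 0 ≤ 1 / (2 * (v : ℝ)) * y ^ 2 := by positivity
  have hdiv : y ^ 2 / (2 * (v : ℝ)) = 1 / (2 * (v : ℝ)) * y ^ 2 := by ring
  rw [windowPenalty]
  split_ifs with h0 h1
  · rw [abs_of_nonneg (by positivity)]
    linarith
  · rw [abs_of_nonneg (by positivity)]
    have : (y - T) ^ 2 / (2 * (v : ℝ)) ≤ y ^ 2 / (2 * (v : ℝ)) :=
      div_le_div_of_nonneg_right (by nlinarith) hv
    linarith
  · have := hC y ⟨by linarith, by linarith⟩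
    rw [Real.norm_eq_abs] at this
    have := abs_add_le (1 / 2) (f y)
    rw [abs_of_pos (by norm_num : (0 : ℝ) < 1 / 2)] at this
    linarith

lemma lintegral_windowPenalty_le (hv : v ≠ 0) (hf : Continuous f) (hT : 0 ≤ T) :
    ∫⁻ y, ENNReal.ofReal ((√(2 * Real.pi * v))⁻¹ * Real.exp (-windowPenalty f T v y)) ≤
      ENNReal.ofReal (1 + (√(2 * Real.pi * v))⁻¹ * Real.exp (-(1 / 2)) *
        ∫ y in (0 : ℝ)..T, Real.exp (-f y)) := by
  set c : ℝ := (√(2 * Real.pi * v))⁻¹ with hc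
  have hc0 : 0 ≤ c := by positivity
  have hG : Measurable (gaussianPDF 0 v) := measurable_gaussianPDF 0 v
  have hexp : Continuous fun y => Real.exp (-f y) := Real.continuous_exp.comp hf.neg
  have hw : Measurable fun y => ENNReal.ofReal (c * Real.exp (-(1 / 2)) * Real.exp (-f y)) :=
    (continuous_const.mul hexp).measurable.ennreal_ofReal
  have hwin : ∫⁻ y in Set.Icc 0 T,
      ENNReal.ofReal (c * Real.exp (-(1 / 2)) * Real.exp (-f y)) =
        ENNReal.ofReal (c * Real.exp (-(1 / 2)) * ∫ y in (0 : ℝ)..T, Real.exp (-f y)) := by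
    have hi : IntegrableOn (fun y => c * Real.exp (-(1 / 2)) * Real.exp (-f y)) (Set.Icc 0 T) :=
      (continuous_const.mul hexp).continuousOn.integrableOn_Icc
    rw [← ofReal_integral_eq_lintegral_ofReal hi
      (Filter.Eventually.of_forall fun y => mul_nonneg (by positivity) (Real.exp_pos _).le),
      integral_const_mul, intervalIntegral.integral_of_le hT, integral_Icc_eq_integral_Ioc]
  have htail : ∫⁻ y in Set.Ioi T, gaussianPDF 0 v (y - T) =
      ∫⁻ y in Set.Ioi 0, gaussianPDF 0 v y := by
    rw [← lintegral_indicator measurableSet_Ioi, ← lintegral_indicator measurableSet_Ioi,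
      ← lintegral_sub_right_eq_self ((Set.Ioi 0).indicator _) T]
    refine lintegral_congr fun y => ?_
    simp [Set.indicator_apply]
  have htot : (∫⁻ y in Set.Iio 0, gaussianPDF 0 v y) + ∫⁻ y in Set.Ioi 0, gaussianPDF 0 v y ≤ 1 := by
    rw [← gaussianReal_apply _ hv, ← gaussianReal_apply _ hv, ← measure_union _ measurableSet_Ioi]
    · exact prob_le_one
    · exact Set.disjoint_left.2 fun y hy hy' => lt_asymm (Set.mem_Iio.1 hy) hy'
  have hP : 0 ≤ ∫ y in (0 : ℝ)..T, Real.exp (-f y) :=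
    intervalIntegral.integral_nonneg hT fun y _ => (Real.exp_pos _).le
  calc _ ≤ ∫⁻ y, ((Set.Iio 0).indicator (gaussianPDF 0 v) y +
        (Set.Ioi T).indicator (fun y => gaussianPDF 0 v (y - T)) y +
        (Set.Icc 0 T).indicator
          (fun y => ENNReal.ofReal (c * Real.exp (-(1 / 2)) * Real.exp (-f y))) y) := by
        refine lintegral_mono fun y => ?_
        rw [windowPenalty]
        split_ifs with h0 h1
        · refine le_add_right (le_add_right (le_of_eq ?_))
          rw [Set.indicator_of_mem (by exact h0), gaussianPDF, gaussianPDFReal, sub_zero, neg_div]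
        · refine le_add_right (le_add_left (le_of_eq ?_))
          rw [Set.indicator_of_mem (by exact h1), gaussianPDF, gaussianPDFReal, sub_zero, neg_div]
        · refine le_add_left (le_of_eq ?_)
          have h2 : y ∈ Set.Icc 0 T := ⟨by linarith, by linarith⟩
          rw [Set.indicator_of_mem h2, neg_add, Real.exp_add, mul_assoc]
    _ = ((∫⁻ y in Set.Iio 0, gaussianPDF 0 v y) + ∫⁻ y in Set.Ioi 0, gaussianPDF 0 v y) +
        ENNReal.ofReal (c * Real.exp (-(1 / 2)) * ∫ y in (0 : ℝ)..T, Real.exp (-f y)) := by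
        rw [lintegral_add_right _ (hw.indicator measurableSet_Icc),
          lintegral_add_left (hG.indicator measurableSet_Iio),
          lintegral_indicator measurableSet_Iio, lintegral_indicator measurableSet_Ioi,
          lintegral_indicator measurableSet_Icc, htail, hwin]
    _ ≤ _ := by
        rw [ENNReal.ofReal_add zero_le_one (by positivity), ENNReal.ofReal_one]
        gcongr

lemma measurable_tailExcess : Measurable (tailExcess T v) :=
  (Measurable.indicator (by fun_prop) measurableSet_Iio).add
    (Measurable.indicator (by fun_prop) measurableSet_Ioi)

lemma abs_tailExcess_le (hT : 0 ≤ T) (y : ℝ) : |tailExcess T v y| ≤ v + 1 * y ^ 2 := by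
  have hv : (0 : ℝ) ≤ v := v.2
  rw [tailExcess, Set.indicator_apply, Set.indicator_apply, abs_le]
  split_ifs with h1 h2 h2 <;> simp only [Set.mem_Iio, Set.mem_Ioi] at * <;>
    constructor <;> nlinarith

/-- For an input between the endpoints of the window, the Gaussian tails cost on average no more
than the level `1 / 2`. -/
lemma integral_tailExcess_nonpos (hv : v ≠ 0) {s : ℝ} (hs0 : 0 ≤ s) (hsT : s ≤ T) :
    ∫ z, tailExcess T v (s + z) ∂gaussianReal 0 v ≤ 0 := by
  have h1 : (fun z => tailExcess T v (s + z)) = fun z =>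
      (Set.Iio (-s)).indicator (fun z => (z - -s) ^ 2 - (v : ℝ)) z +
        (Set.Ioi (T - s)).indicator (fun z => (z - (T - s)) ^ 2 - (v : ℝ)) z := by
    funext z
    rw [tailExcess]
    simp only [Set.indicator_apply, Set.mem_Iio, Set.mem_Ioi]
    congr 1
    · exact if_congr (by constructor <;> intro h <;> linarith) (by ring) rfl
    · exact if_congr (by constructor <;> intro h <;> linarith) (by ring) rfl
  have hi : ∀ a : ℝ, Integrable (fun z : ℝ => (z - a) ^ 2 - (v : ℝ)) (gaussianReal 0 v) :=
    fun a => (integrable_quadratic_gaussianReal 1 (-2 * a) (a ^ 2 - v)).congr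
      (Filter.Eventually.of_forall fun z => by simp only; ring)
  rw [h1, integral_add ((hi _).indicator measurableSet_Iio) ((hi _).indicator measurableSet_Ioi),
    integral_indicator measurableSet_Iio, integral_indicator measurableSet_Ioi]
  exact add_nonpos (setIntegral_Iio_sq_sub_le hv (by linarith))
    (setIntegral_Ioi_sq_sub_le hv (by linarith))

variable {X : Type*} [MeasurableSpace X] {μ : Measure X} [IsProbabilityMeasure μ] {s : X → ℝ}

lemma integral_sq_gaussianReal : ∫ z : ℝ, z ^ 2 ∂gaussianReal 0 v = v := by
  have h := variance_of_integral_eq_zero (μ := gaussianReal 0 v) (X := fun z => z)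
    (by fun_prop) (by simp)
  rw [variance_fun_id_gaussianReal] at h
  exact h.symm

lemma integrable_window_output (hs : Measurable s) (hf : Continuous f) :
    Integrable (fun p : X × ℝ => (Set.Icc 0 T).indicator f (s p.1 + p.2))
      (μ.prod (gaussianReal 0 v)) := by
  obtain ⟨C, hC⟩ := (isCompact_Icc (a := (0 : ℝ)) (b := T)).exists_bound_of_continuousOn
    hf.continuousOn
  refine (integrable_const (max C 0)).mono'
    ((hf.measurable.indicator measurableSet_Icc).comp (by fun_prop)).aestronglyMeasurable
    (Filter.Eventually.of_forall fun p => ?_)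
  by_cases h : s p.1 + p.2 ∈ Set.Icc 0 T
  · rw [Set.indicator_of_mem h]
    exact (hC _ h).trans (le_max_left _ _)
  · rw [Set.indicator_of_notMem h, norm_zero]
    exact le_max_right _ _

/-- Capacity-type bound obtained from the auxiliary law with weight `exp (-f)` on the window
`[0, T]`. The relative weight of window and tails is the one that makes the constant terms inside
and outside of the window agree, so that the probability of the window drops out. -/
theorem mutualInfo_jointLaw_le_window {σ : ℝ} (hσ : 0 < σ) (hs : Measurable s)
    (h01 : ∀ᵐ x ∂μ, 0 ≤ s x ∧ s x ≤ 1) (hf : Continuous f) (hT : 1 ≤ T) :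
    mutualInfo (jointLaw μ s (σ ^ 2).toNNReal) ≠ ∞ ∧
      (mutualInfo (jointLaw μ s (σ ^ 2).toNNReal)).toReal ≤
      Real.log (1 + (∫ y in (0 : ℝ)..T, Real.exp (-f y)) / (√(2 * Real.pi * Real.exp 1) * σ)) +
      ∫ p, (Set.Icc 0 T).indicator f (s p.1 + p.2)
        ∂(μ.prod (gaussianReal 0 (σ ^ 2).toNNReal)) := by
  have hv := toNNReal_sq_ne_zero hσ
  have hT0 : 0 ≤ T := by linarith
  set v := (σ ^ 2).toNNReal with hvdef
  have hvc : (v : ℝ) = σ ^ 2 := Real.coe_toNNReal _ (sq_nonneg σ)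
  have hvpos : (0 : ℝ) < v := by rw [hvc]; positivity
  set P := ∫ y in (0 : ℝ)..T, Real.exp (-f y) with hPdef
  have hP : 0 ≤ P := intervalIntegral.integral_nonneg hT0 fun y _ => (Real.exp_pos _).le
  set c : ℝ := (√(2 * Real.pi * v))⁻¹ with hc
  have hc0 : 0 < c := by positivity
  set K : ℝ := 1 + P / (√(2 * Real.pi * Real.exp 1) * σ) with hK
  have hK0 : 0 < K := by positivity
  have hKeq : 1 + c * Real.exp (-(1 / 2)) * P = K := by
    rw [hK, hc, hvc, Real.sqrt_mul (by positivity), Real.sqrt_sq hσ.le,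
      Real.sqrt_mul (by positivity) (Real.exp 1), ← Real.exp_half, Real.exp_neg]
    field_simp
  set r : ℝ → ℝ := fun y => K⁻¹ * (c * Real.exp (-windowPenalty f T v y)) with hr
  have hrm : Measurable r :=
    ((measurable_windowPenalty hf).neg.exp.const_mul c).const_mul _
  have hr0 : ∀ y, 0 < r y := fun y => by positivity
  have hlog : ∀ y, Real.log (r y) = -Real.log K + Real.log c - windowPenalty f T v y := fun y => by
    rw [hr, Real.log_mul (by positivity) (by positivity), Real.log_mul hc0.ne' (by positivity),
      Real.log_exp, Real.log_inv]
    ring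
  have hr1 : ∫⁻ y, ENNReal.ofReal (r y) ≤ 1 := by
    have h := lintegral_windowPenalty_le (f := f) hv hf hT0
    rw [← hc, ← hPdef, hKeq] at h
    simp_rw [hr, ENNReal.ofReal_mul (inv_nonneg.2 hK0.le)]
    rw [lintegral_const_mul _ (by
      exact ((measurable_windowPenalty hf).neg.exp.const_mul c).ennreal_ofReal)]
    refine (mul_le_mul_right h _).trans ?_
    rw [← ENNReal.ofReal_mul (inv_nonneg.2 hK0.le), inv_mul_cancel₀ hK0.ne', ENNReal.ofReal_one]
  obtain ⟨C, hC⟩ := exists_abs_windowPenalty_le hf hT0 v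
  have hrb : ∀ y, |Real.log (r y)| ≤
      (|-Real.log K + Real.log c| + C) + 1 / (2 * v) * y ^ 2 := fun y => by
    rw [hlog]
    exact (abs_sub _ _).trans (by linarith [hC y])
  obtain ⟨hne, hle⟩ := mutualInfo_jointLaw_le (μ := μ) hs h01 hv hrm hr0 hr1 (by positivity) hrb
  refine ⟨hne, hle.trans ?_⟩
  have hw : Integrable (fun p : X × ℝ => (Set.Icc 0 T).indicator f (s p.1 + p.2))
      (μ.prod (gaussianReal 0 v)) := integrable_window_output hs hf
  have ht : Integrable (fun p : X × ℝ => tailExcess T v (s p.1 + p.2))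
      (μ.prod (gaussianReal 0 v)) :=
    integrable_comp_output hs h01 measurable_tailExcess zero_le_one (abs_tailExcess_le hT0)
  have hsq : Integrable (fun p : X × ℝ => p.2 ^ 2) (μ.prod (gaussianReal 0 v)) :=
    (integrable_sq_gaussianReal 0 v).comp_snd μ
  have hpt : (fun p : X × ℝ => Real.log (gaussianPDFReal 0 v p.2) - Real.log (r (s p.1 + p.2))) =
      fun p => (Real.log K + 1 / 2) + (Set.Icc 0 T).indicator f (s p.1 + p.2) +
        (2 * (v : ℝ))⁻¹ * tailExcess T v (s p.1 + p.2) - (2 * (v : ℝ))⁻¹ * p.2 ^ 2 := by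
    funext p
    rw [hlog, log_gaussianPDFReal hv, windowPenalty_eq hv hT0, ← hc]
    ring
  have htle : ∫ p, tailExcess T v (s p.1 + p.2) ∂(μ.prod (gaussianReal 0 v)) ≤ 0 := by
    rw [integral_prod _ ht]
    refine integral_nonpos_of_ae (h01.mono fun x hx => ?_)
    exact integral_tailExcess_nonpos hv hx.1 (hx.2.trans hT)
  have hsqint : ∫ p : X × ℝ, p.2 ^ 2 ∂(μ.prod (gaussianReal 0 v)) = v := by
    rw [integral_prod _ hsq]
    simp [integral_sq_gaussianReal]
  have hw' : Integrable (fun p : X × ℝ => (Real.log K + 1 / 2) +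
      (Set.Icc 0 T).indicator f (s p.1 + p.2)) (μ.prod (gaussianReal 0 v)) :=
    (integrable_const _).add hw
  have hwt : Integrable (fun p : X × ℝ => (Real.log K + 1 / 2) +
      (Set.Icc 0 T).indicator f (s p.1 + p.2) +
      (2 * (v : ℝ))⁻¹ * tailExcess T v (s p.1 + p.2)) (μ.prod (gaussianReal 0 v)) :=
    hw'.add (ht.const_mul _)
  rw [hpt, integral_sub hwt (hsq.const_mul _), integral_add hw' (ht.const_mul _),
    integral_add (integrable_const _) hw, integral_const_mul, integral_const_mul, hsqint]
  have h1 : (2 * (v : ℝ))⁻¹ * v = 1 / 2 := by field_simp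
  have h2 : (2 * (v : ℝ))⁻¹ * ∫ p, tailExcess T v (s p.1 + p.2) ∂(μ.prod (gaussianReal 0 v)) ≤ 0 :=
    mul_nonpos_of_nonneg_of_nonpos (by positivity) htle
  rw [h1]
  simp only [integral_const, probReal_univ, one_smul]
  linarith

end Window

/-! ### Gains, averages and the equal-cost constraints -/

section Gains

variable {n : ℕ} {h α : Fin n → ℝ}

lemma cumGain_zero : cumGain h 0 = 0 := by simp [cumGain]

lemma one_sub_cumGain (hsum : ∑ k, h k = 1) (i : ℕ) :
    1 - cumGain h i = ∑ k : Fin n with i ≤ k.val, h k := by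
  rw [cumGain, ← hsum, ← Finset.sum_filter_add_sum_filter_not Finset.univ (fun k => k.val < i)]
  simp

lemma cumGain_nonneg (hpos : ∀ k, 0 < h k) (i : ℕ) : 0 ≤ cumGain h i :=
  Finset.sum_nonneg fun k _ => (hpos k).le

lemma cumGain_lt_one (hpos : ∀ k, 0 < h k) (hsum : ∑ k, h k = 1) {i : ℕ} (hi : i < n) :
    cumGain h i < 1 := by
  have h1 : 0 < ∑ k : Fin n with i ≤ k.val, h k :=
    Finset.sum_pos (fun k _ => hpos k) ⟨⟨i, hi⟩, by simp⟩
  linarith [one_sub_cumGain hsum i]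

lemma one_sub_cumGain_mul_avgTail (hpos : ∀ k, 0 < h k) (hsum : ∑ k, h k = 1) {i : ℕ}
    (hi : i < n) : (1 - cumGain h i) * avgTail h α i = ∑ k : Fin n with i ≤ k.val, h k * α k :=
  mul_div_cancel₀ _ (sub_pos.2 (cumGain_lt_one hpos hsum hi)).ne'

lemma weightedSum_mem_Icc (hpos : ∀ k, 0 < h k) (hsum : ∑ k, h k = 1) {x : Fin n → ℝ}
    (hx : ∀ k, 0 ≤ x k ∧ x k ≤ 1) : 0 ≤ ∑ k, h k * x k ∧ ∑ k, h k * x k ≤ 1 :=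
  ⟨Finset.sum_nonneg fun k _ => mul_nonneg (hpos k).le (hx k).1, hsum ▸
    Finset.sum_le_sum fun k _ => mul_le_of_le_one_right (hpos k).le (hx k).2⟩

/-- The first `i` transmitters contribute at most `H_[i]`, so the excess of the received intensity
over `H_[i]` is at most the contribution of the others. -/
lemma posPart_weightedSum_sub_le (hpos : ∀ k, 0 < h k) {x : Fin n → ℝ}
    (hx : ∀ k, 0 ≤ x k ∧ x k ≤ 1) (i : ℕ) :
    max (∑ k, h k * x k - cumGain h i) 0 ≤ ∑ k : Fin n with i ≤ k.val, h k * x k := by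
  refine max_le ?_ (Finset.sum_nonneg fun k _ => mul_nonneg (hpos k).le (hx k).1)
  rw [← Finset.sum_filter_add_sum_filter_not Finset.univ (fun k : Fin n => k.val < i), cumGain]
  simp only [not_lt]
  have : ∑ k : Fin n with k.val < i, h k * x k ≤ ∑ k : Fin n with k.val < i, h k :=
    Finset.sum_le_sum fun k _ => mul_le_of_le_one_right (hpos k).le (hx k).2
  linarith

lemma measurable_weightedSum : Measurable fun x : Fin n → ℝ => ∑ k, h k * x k := by fun_prop

variable {μ : Measure (Fin n → ℝ)}

lemma EqualCost.integrable_coord (hμ : EqualCost α μ) (k : Fin n) :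
    Integrable (fun x : Fin n → ℝ => x k) μ := by
  have := hμ.prob
  refine (integrable_const (1 : ℝ)).mono'
    (measurable_pi_apply k).aestronglyMeasurable (hμ.peak.mono fun x hx => ?_)
  rw [Real.norm_of_nonneg (hx k).1]
  exact (hx k).2

lemma EqualCost.integral_weightedSum (hμ : EqualCost α μ) (S : Finset (Fin n)) :
    ∫ x, ∑ k ∈ S, h k * x k ∂μ = ∑ k ∈ S, h k * α k := by
  rw [integral_finsetSum _ fun k _ => (hμ.integrable_coord k).const_mul _]
  simp_rw [integral_const_mul, hμ.mean]

lemma equalCost_dirac (hα : ∀ k, 0 < α k ∧ α k ≤ 1) : EqualCost α (Measure.dirac α) where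
  prob := inferInstance
  peak := by
    rw [ae_dirac_eq]
    exact fun k => ⟨(hα k).1.le, (hα k).2⟩
  mean k := integral_dirac _ _

/-- A real bound valid for every admissible input law bounds the capacity. The point mass at `α`
is admissible, so such a bound is nonnegative. -/
lemma capacityE_le_of_forall {σ B : ℝ} (hα : ∀ k, 0 < α k ∧ α k ≤ 1)
    (hB : ∀ μ, EqualCost α μ → mutualInfo (channelLaw h σ μ) ≠ ∞ ∧
      (mutualInfo (channelLaw h σ μ)).toReal ≤ B) :
    (capacityE h α σ : EReal) ≤ (B : EReal) := by
  have hB0 : 0 ≤ B := ENNReal.toReal_nonneg.trans (hB _ (equalCost_dirac hα)).2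
  have hle : capacityE h α σ ≤ ENNReal.ofReal B :=
    iSup₂_le fun μ hμ => (ENNReal.le_ofReal_iff_toReal_le (hB μ hμ).1 hB0).2 (hB μ hμ).2
  calc (capacityE h α σ : EReal) ≤ (ENNReal.ofReal B : EReal) := by exact_mod_cast hle
    _ = B := by rw [EReal.coe_ennreal_ofReal, max_eq_left hB0]

end Gains

/-! ### The capacity bounds -/

section Capacity

variable {n : ℕ} {h α : Fin n → ℝ} {μ : Measure (Fin n → ℝ)} {σ δ : ℝ}

/-- The piecewise linear function `λ₀ y + ∑ λ_i (y - H_[i])₊` in the exponent of `normP`. -/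
def tilt (h : Fin n → ℝ) (lam : ℕ → ℝ) (y : ℝ) : ℝ :=
  lam 0 * y + ∑ i ∈ Finset.Ico 1 n, lam i * max (y - cumGain h i) 0

lemma continuous_tilt (lam : ℕ → ℝ) : Continuous (tilt h lam) := by
  unfold tilt
  fun_prop

lemma normP_eq (lam : ℕ → ℝ) :
    normP h lam δ = ∫ y in (0 : ℝ)..(1 + δ), Real.exp (-tilt h lam y) := by
  simp only [normP, tilt, neg_add, neg_mul, sub_eq_add_neg]

lemma indicator_tilt (lam : ℕ → ℝ) (S : Set ℝ) (y : ℝ) :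
    S.indicator (tilt h lam) y = lam 0 * S.indicator (fun y => y) y +
      ∑ i ∈ Finset.Ico 1 n, lam i * S.indicator (fun y => max (y - cumGain h i) 0) y := by
  by_cases hy : y ∈ S <;> simp [hy, tilt]

lemma EqualCost.integral_window_le (hμ : EqualCost α μ) (hpos : ∀ k, 0 < h k)
    (hsum : ∑ k, h k = 1) (hσ : 0 < σ) (hδ : 0 < δ) {i : ℕ} (hi : i < n) :
    ∫ p : (Fin n → ℝ) × ℝ, (Set.Icc 0 (1 + δ)).indicator (fun y => max (y - cumGain h i) 0)
        (∑ k, h k * p.1 k + p.2) ∂(μ.prod (gaussianReal 0 (σ ^ 2).toNNReal)) ≤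
      (1 - cumGain h i) * avgTail h α i +
        σ / √(2 * Real.pi) * (1 - Real.exp (-(1 + δ) ^ 2 / (2 * σ ^ 2))) := by
  have := hμ.prob
  have hw := integrable_window_output (μ := μ) (T := 1 + δ) (v := (σ ^ 2).toNNReal)
    (f := fun y => max (y - cumGain h i) 0) (measurable_weightedSum (h := h)) (by fun_prop)
  have hint : Integrable (fun x : Fin n → ℝ => ∑ k : Fin n with i ≤ k.val, h k * x k) μ :=
    integrable_finsetSum _ fun k _ => (hμ.integrable_coord k).const_mul _
  rw [integral_prod _ hw, one_sub_cumGain_mul_avgTail hpos hsum hi, ← hμ.integral_weightedSum]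
  calc _ ≤ ∫ x, (∑ k : Fin n with i ≤ k.val, h k * x k +
        σ / √(2 * Real.pi) * (1 - Real.exp (-(1 + δ) ^ 2 / (2 * σ ^ 2)))) ∂μ := by
        refine integral_mono_ae hw.integral_prod_left (hint.add (integrable_const _))
          (hμ.peak.mono fun x hx => ?_)
        have hs := weightedSum_mem_Icc hpos hsum hx
        refine (integral_window_posPart_le hσ hs.1 (by linarith) (cumGain_nonneg hpos i)
          (by linarith [cumGain_lt_one hpos hsum hi])).trans ?_
        exact add_le_add (posPart_weightedSum_sub_le hpos hx i) le_rfl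
    _ = _ := by
        rw [integral_add hint (integrable_const _)]
        simp

lemma EqualCost.le_integral_window (hμ : EqualCost α μ) (hpos : ∀ k, 0 < h k)
    (hsum : ∑ k, h k = 1) (hσ : 0 < σ) (hδ : 0 < δ) :
    ∑ k, h k * α k + σ * (gaussPhi (1 / σ) - gaussPhi (δ / σ)) -
        (gaussQ (1 / σ) + gaussQ (δ / σ)) ≤
      ∫ p : (Fin n → ℝ) × ℝ, (Set.Icc 0 (1 + δ)).indicator (fun y => y)
        (∑ k, h k * p.1 k + p.2) ∂(μ.prod (gaussianReal 0 (σ ^ 2).toNNReal)) := by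
  have := hμ.prob
  have hw := integrable_window_output (μ := μ) (T := 1 + δ) (v := (σ ^ 2).toNNReal)
    (f := fun y => y) (measurable_weightedSum (h := h)) (by fun_prop)
  have hint : Integrable (fun x : Fin n → ℝ => ∑ k, h k * x k) μ :=
    integrable_finsetSum _ fun k _ => (hμ.integrable_coord k).const_mul _
  have hint' : Integrable (fun x : Fin n → ℝ => ∑ k, h k * x k +
      σ * (gaussPhi (1 / σ) - gaussPhi (δ / σ))) μ := hint.add (integrable_const _)
  rw [integral_prod _ hw]
  calc _ = ∫ x, (∑ k, h k * x k + σ * (gaussPhi (1 / σ) - gaussPhi (δ / σ)) -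
        (gaussQ (1 / σ) + gaussQ (δ / σ))) ∂μ := by
        rw [integral_sub hint' (integrable_const _), integral_add hint (integrable_const _),
          hμ.integral_weightedSum]
        simp
    _ ≤ _ := integral_mono_ae (hint'.sub (integrable_const _)) hw.integral_prod_left
        (hμ.peak.mono fun x hx =>
          le_integral_window_id hσ hδ (weightedSum_mem_Icc hpos hsum hx).2)

/-- The bound for a single input law, with the mean of the windowed output, the factor of `λ₀`,
not yet estimated. -/
lemma EqualCost.mutualInfo_channelLaw_le (hμ : EqualCost α μ) (hpos : ∀ k, 0 < h k)
    (hsum : ∑ k, h k = 1) (hσ : 0 < σ) (hδ : 0 < δ) {lam : ℕ → ℝ}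
    (hlam : ∀ i, 1 ≤ i → i < n → 0 ≤ lam i) :
    mutualInfo (channelLaw h σ μ) ≠ ∞ ∧ (mutualInfo (channelLaw h σ μ)).toReal ≤
      Real.log (1 + normP h lam δ / (√(2 * Real.pi * Real.exp 1) * σ)) +
      lam 0 * ∫ p : (Fin n → ℝ) × ℝ, (Set.Icc 0 (1 + δ)).indicator (fun y => y)
        (∑ k, h k * p.1 k + p.2) ∂(μ.prod (gaussianReal 0 (σ ^ 2).toNNReal)) +
      ∑ i ∈ Finset.Ico 1 n, lam i * ((1 - cumGain h i) * avgTail h α i +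
        σ / √(2 * Real.pi) * (1 - Real.exp (-(1 + δ) ^ 2 / (2 * σ ^ 2)))) := by
  have := hμ.prob
  obtain ⟨hne, hle⟩ := mutualInfo_jointLaw_le_window (μ := μ) (T := 1 + δ) hσ
    (measurable_weightedSum (h := h)) (hμ.peak.mono fun x hx => weightedSum_mem_Icc hpos hsum hx)
    (continuous_tilt (h := h) lam) (by linarith)
  refine ⟨hne, hle.trans ?_⟩
  have hw : ∀ f : ℝ → ℝ, Continuous f → Integrable (fun p : (Fin n → ℝ) × ℝ =>
      (Set.Icc 0 (1 + δ)).indicator f (∑ k, h k * p.1 k + p.2))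
      (μ.prod (gaussianReal 0 (σ ^ 2).toNNReal)) :=
    fun f hf => integrable_window_output measurable_weightedSum hf
  have hw' : ∀ i ∈ Finset.Ico 1 n, Integrable (fun p : (Fin n → ℝ) × ℝ =>
      lam i * (Set.Icc 0 (1 + δ)).indicator (fun y => max (y - cumGain h i) 0)
        (∑ k, h k * p.1 k + p.2)) (μ.prod (gaussianReal 0 (σ ^ 2).toNNReal)) :=
    fun i _ => (hw _ (by fun_prop)).const_mul _
  simp_rw [indicator_tilt]
  rw [← normP_eq, integral_add ((hw _ (by fun_prop)).const_mul _) (integrable_finsetSum _ hw'),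
    integral_finsetSum _ hw', integral_const_mul, add_assoc]
  gcongr with i hi
  rw [integral_const_mul]
  obtain ⟨h1, h2⟩ := Finset.mem_Ico.1 hi
  exact mul_le_mul_of_nonneg_left (hμ.integral_window_le hpos hsum hσ hδ h2) (hlam i h1 h2)

end Capacity

end OIC

end

theorem theorem7 (n : ℕ) (hn : 2 ≤ n) (h α : Fin n → ℝ) (σ : ℝ)
    (hh_pos : ∀ k, 0 < h k) (hh_sum : ∑ k, h k = 1)
    (hα_mem : ∀ k, 0 < α k ∧ α k ≤ 1) (hα_anti : StrictAnti α)
    (hα_last : α ⟨n - 1, by omega⟩ ≤ 1 / 2) (hσ : 0 < σ) :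
    (∀ (δ : ℝ) (lam : ℕ → ℝ), 0 < δ → (∀ i, i < n → 0 ≤ lam i) →
      (OIC.capacityE h α σ : EReal) ≤
        ((Real.log (1 + OIC.normP h lam δ / (√(2 * Real.pi * Real.exp 1) * σ))
          + ∑ i ∈ Finset.range n, lam i * (1 - OIC.cumGain h i) * OIC.avgTail h α i
          + ∑ i ∈ Finset.range n, lam i * σ / √(2 * Real.pi)
              * (1 - Real.exp (-(1 + δ) ^ 2 / (2 * σ ^ 2))) : ℝ) : EReal)) ∧
    (∀ (δ : ℝ) (lam : ℕ → ℝ), 0 < δ → lam 0 ≤ 0 → (∀ i, 1 ≤ i → i < n → 0 ≤ lam i) →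
      (OIC.capacityE h α σ : EReal) ≤
        ((Real.log (1 + OIC.normP h lam δ / (√(2 * Real.pi * Real.exp 1) * σ))
          + ∑ i ∈ Finset.range n, lam i * (1 - OIC.cumGain h i) * OIC.avgTail h α i
          + ∑ i ∈ Finset.Ico 1 n, lam i * σ / √(2 * Real.pi)
              * (1 - Real.exp (-(1 + δ) ^ 2 / (2 * σ ^ 2)))
          + lam 0 * σ * (OIC.gaussPhi (1 / σ) - OIC.gaussPhi (δ / σ))
          - lam 0 * (OIC.gaussQ (1 / σ) + OIC.gaussQ (δ / σ)) : ℝ) : EReal)) := by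
  have hn0 : 0 < n := by omega
  have hsplit : ∀ F : ℕ → ℝ, ∑ i ∈ Finset.range n, F i = F 0 + ∑ i ∈ Finset.Ico 1 n, F i :=
    fun F => by rw [Finset.range_eq_Ico, Finset.sum_eq_sum_Ico_succ_bot hn0]
  have hdist : ∀ (δ : ℝ) (lam : ℕ → ℝ), ∑ i ∈ Finset.Ico 1 n,
      lam i * ((1 - OIC.cumGain h i) * OIC.avgTail h α i +
        σ / √(2 * Real.pi) * (1 - Real.exp (-(1 + δ) ^ 2 / (2 * σ ^ 2)))) =
      ∑ i ∈ Finset.Ico 1 n, lam i * (1 - OIC.cumGain h i) * OIC.avgTail h α i +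
        ∑ i ∈ Finset.Ico 1 n, lam i * σ / √(2 * Real.pi)
          * (1 - Real.exp (-(1 + δ) ^ 2 / (2 * σ ^ 2))) := fun δ lam => by
    rw [← Finset.sum_add_distrib]
    exact Finset.sum_congr rfl fun i _ => by ring
  refine ⟨fun δ lam hδ hlam => ?_, fun δ lam hδ hlam0 hlam => ?_⟩
  · refine OIC.capacityE_le_of_forall hα_mem fun μ hμ => ?_
    obtain ⟨hne, hle⟩ :=
      hμ.mutualInfo_channelLaw_le hh_pos hh_sum hσ hδ (fun i _ => hlam i)
    refine ⟨hne, hle.trans ?_⟩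
    -- on the window, `y = (y - H_[0])₊`
    have hwin : (Set.Icc 0 (1 + δ)).indicator (fun y : ℝ => y) =
        (Set.Icc 0 (1 + δ)).indicator (fun y => max (y - OIC.cumGain h 0) 0) :=
      Set.indicator_congr fun y hy => by rw [OIC.cumGain_zero, sub_zero, max_eq_left hy.1]
    have h0 := mul_le_mul_of_nonneg_left
      (hμ.integral_window_le hh_pos hh_sum hσ hδ hn0) (hlam 0 hn0)
    rw [hdist, hsplit, hsplit, hwin]
    refine (add_le_add_left (add_le_add_right h0 _) _).trans_eq ?_
    ring
  · refine OIC.capacityE_le_of_forall hα_mem fun μ hμ => ?_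
    obtain ⟨hne, hle⟩ := hμ.mutualInfo_channelLaw_le hh_pos hh_sum hσ hδ hlam
    refine ⟨hne, hle.trans ?_⟩
    have h0 := mul_le_mul_of_nonpos_left (hμ.le_integral_window hh_pos hh_sum hσ hδ) hlam0
    have hmean := OIC.one_sub_cumGain_mul_avgTail (α := α) hh_pos hh_sum hn0
    simp only [zero_le, Finset.filter_true] at hmean
    rw [← hmean] at h0
    rw [hdist, hsplit]
    refine (add_le_add_left (add_le_add_right h0 _) _).trans_eq ?_
    ring
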